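/- Let $n\ge 2$, let $\alpha\in\mathbb R^n$, and let $M$ be a symmetric positive definite $n\times n$ matrix with integer entries. Put $Q_M(x)=\langle Mx,x\rangle$ for $x\in\mathbb R^n$, let $|E^M|$ be the volume of the ellipsoid $\{x\in\mathbb R^n: Q_M(x)\le 1\}$, and for $t>0$ let $$N_M(t)=\#\{m\in\mathbb Z^n: Q_M(m-\alpha)\le t^2\}.$$ For $t>0$ and $\varepsilon>0$ define $$F_M(t)=\frac{N_M(t)-|E^M|\,t^n}{t^{(n-1)/2}},\qquad S_M(t,\varepsilon)=\frac{N_M(t+\varepsilon)-N_M(t)-|E^M|\big((t+\varepsilon)^n-t^n\big)}{\sqrt{\varepsilon}\;t^{(n-1)/2}}.$$ Let $\mu\in C_c^\infty(\mathbb R)$ be nonnegative with support contained in $(0,\infty)$ and $\int_{\mathbb R}\mu(t)\,dt=1$, and for $T>0$ write $$\langle f\rangle_T=\frac1T\int_{\mathbb R} f(t)\,\mu\!\left(\frac tT\right)dt .$$ Then the integrals defining $\langle F_M\rangle_T$ and $\langle S_M(\cdot,\varepsilon)\rangle_T$ converge absolutely for all $T>0$ and $\varepsilon>0$, and: (a)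 $\displaystyle\lim_{T\to\infty}\langle F_M\rangle_T=0$; (b) for all $L>0$ and $C>0$, $\langle S_M(\cdot,\varepsilon)\rangle_T\to0$ as $T\to\infty$, uniformly over all $\varepsilon$ with $T^{-L}<\varepsilon\le C$. -/

import Mathlib

open scoped ContDiff Topology
open MeasureTheory Filter

namespace EllipsoidLattice

/-- The class of symmetric positive definite matrices with integer entries
(positive definiteness is tested on all real vectors). -/
def IsPosDefInt {n : ℕ} (M : Matrix (Fin n) (Fin n) ℤ) : Prop :=
  (M.map (fun a : ℤ => (a : ℝ))).PosDef

/-- The quadratic form `x ↦ ⟨M x, x⟩` on `ℝⁿ`. -/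
def quadForm {n : ℕ} (M : Matrix (Fin n) (Fin n) ℤ) (x : Fin n → ℝ) : ℝ :=
  (M.map (fun a : ℤ => (a : ℝ))).mulVec x ⬝ᵥ x

/-- The closed ellipsoid of radius `t` centred at `c`. -/
def ellipsoid {n : ℕ} (M : Matrix (Fin n) (Fin n) ℤ) (c : Fin n → ℝ) (t : ℝ) :
    Set (Fin n → ℝ) :=
  {x | quadForm M (x - c) ≤ t ^ 2}

/-- The volume (Lebesgue measure) of the ellipsoid of radius one. -/
noncomputable def ellipsoidVolume {n : ℕ} (M : Matrix (Fin n) (Fin n) ℤ) : ℝ :=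
  (volume (ellipsoid M 0 1)).toReal

/-- The number of points of `ℤⁿ` in the ellipsoid of radius `t` centred at `α`. -/
noncomputable def latticeCount {n : ℕ} (M : Matrix (Fin n) (Fin n) ℤ) (α : Fin n → ℝ)
    (t : ℝ) : ℝ :=
  (({m : Fin n → ℤ | (fun i => (m i : ℝ)) ∈ ellipsoid M α t} : Set (Fin n → ℤ)).ncard : ℝ)

/-- The normalized deviation of the lattice point count in the ellipsoid. -/
noncomputable def deviation {n : ℕ} (M : Matrix (Fin n) (Fin n) ℤ) (α : Fin n → ℝ)
    (t : ℝ) : ℝ :=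
  (latticeCount M α t - ellipsoidVolume M * t ^ n) / t ^ (((n : ℝ) - 1) / 2)

/-- The normalized deviation of the lattice point count in the shell between the
ellipsoids of radii `t` and `t + ε`. -/
noncomputable def shellDeviation {n : ℕ} (M : Matrix (Fin n) (Fin n) ℤ) (α : Fin n → ℝ)
    (t ε : ℝ) : ℝ :=
  (latticeCount M α (t + ε) - latticeCount M α t
      - ellipsoidVolume M * ((t + ε) ^ n - t ^ n)) /
    (Real.sqrt ε * t ^ (((n : ℝ) - 1) / 2))

/-- The rescaled weight `μ_T(t) = T⁻¹ μ(t / T)`. -/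
noncomputable def rescale (μ : ℝ → ℝ) (T t : ℝ) : ℝ := 1 / T * μ (t / T)

/-- The smooth average `⟨f⟩_T = ∫ f(t) μ_T(t) dt`. -/
noncomputable def smoothAverage (μ : ℝ → ℝ) (T : ℝ) (f : ℝ → ℝ) : ℝ :=
  ∫ t : ℝ, f t * rescale μ T t

end EllipsoidLattice

open EllipsoidLattice

open EllipsoidLattice

namespace EllipsoidLattice

/-! The average against `μ` smooths out the sharp cutoff of the count. Interchanging sum and
integral turns the averaged `latticeCount` into a sum over `ℤⁿ - α`, at scale `T`, of a smooth
compactly supported function of `x`. The averaged volume term is the integral of that same function.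
A smooth lattice sum at scale `T` differs from its integral by `O(T^{-K})` for every `K`, so both
averages tend to zero faster than any power of `T`; the normalizing factor `(√ε)⁻¹` costs only a
power of `T`.

The usual argument for this decay is Poisson summation. Here it is replaced by periodicity: as a
function of the shift `y`, the lattice sum has period one in each coordinate, and each derivative
brings out a factor `T⁻¹`. By Rolle the derivative vanishes somewhere in each period, so by the mean
value theorem it is bounded by the next derivative, and iteration gains any power of `T`
(`abs_latticeSum_sndDeriv_le`). The sum is thus almost independent of the shift, and its mean over a
unit cube of shifts is the integral (`abs_latticeSum_sub_integral_le`).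

Uniformity in `ε` comes from treating the shift as a parameter `ρ = √(ε/T)` of one smooth compactly
supported kernel on `ℝ × ℝⁿ`, with constants independent of `ρ` (`radialKernel`,
`abs_integral_discrepancy_mul_comp_le`). -/

/-! ### Smooth lattice sums as functions of the shift -/

/-- The lattice points with `‖m + y‖ ≤ A` lie in a finite box of controlled size. -/
theorem exists_lattice_box {n : ℕ} (y : Fin n → ℝ) {A : ℝ} (hA : 0 ≤ A) :
    ∃ B : Finset (Fin n → ℤ), (B.card : ℝ) ≤ (2 * A + 1) ^ n ∧
      ∀ m : Fin n → ℤ, ‖(fun i => (m i : ℝ)) + y‖ ≤ A → m ∈ B := by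
  refine ⟨Fintype.piFinset fun i => Finset.Icc ⌈-y i - A⌉ ⌊-y i + A⌋, ?_, fun m hm => ?_⟩
  · rw [Fintype.card_piFinset]
    push_cast
    calc _ ≤ ∏ _i : Fin n, (2 * A + 1) := by
          refine Finset.prod_le_prod (fun _ _ => by positivity) fun i _ => ?_
          rw [Int.card_Icc]
          have h1 := Int.floor_le (-y i + A)
          have h2 := Int.le_ceil (-y i - A)
          rcases le_total (⌊-y i + A⌋ + 1 - ⌈-y i - A⌉) 0 with h | h
          · rw [Int.toNat_of_nonpos h]
            push_cast
            linarith
          · have h3 : (((⌊-y i + A⌋ + 1 - ⌈-y i - A⌉).toNat : ℕ) : ℝ)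
                = ((⌊-y i + A⌋ + 1 - ⌈-y i - A⌉ : ℤ) : ℝ) := by
              exact_mod_cast congrArg (Int.cast : ℤ → ℝ) (Int.toNat_of_nonneg h)
            rw [h3]
            push_cast
            linarith
      _ = _ := by simp
  · rw [Fintype.mem_piFinset]
    intro i
    have h := (norm_le_pi_norm _ i).trans hm
    rw [Real.norm_eq_abs, abs_le] at h
    simp only [Pi.add_apply] at h
    rw [Finset.mem_Icc, Int.ceil_le, Int.le_floor]
    constructor <;> linarith

/-- The sum of `F (ρ, ·)` over the lattice `T⁻¹ (ℤⁿ + y)`. -/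
noncomputable def latticeSum {n : ℕ} (F : ℝ × (Fin n → ℝ) → ℝ) (T ρ : ℝ) (y : Fin n → ℝ) : ℝ :=
  ∑' m : Fin n → ℤ, F (ρ, T⁻¹ • ((fun i => (m i : ℝ)) + y))

/-- The derivative of `F : ℝ × ℝⁿ → ℝ` in the direction `v` of the second factor. -/
noncomputable def sndDeriv {n : ℕ} (v : Fin n → ℝ) (F : ℝ × (Fin n → ℝ) → ℝ) :
    ℝ × (Fin n → ℝ) → ℝ :=
  fun z => fderiv ℝ F z (0, v)

theorem contDiff_sndDeriv {n : ℕ} (v : Fin n → ℝ) {F : ℝ × (Fin n → ℝ) → ℝ}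
    (hF : ContDiff ℝ ∞ F) : ContDiff ℝ ∞ (sndDeriv v F) :=
  (hF.fderiv_right (m := ∞) (by simp)).clm_apply contDiff_const

theorem hasCompactSupport_sndDeriv {n : ℕ} (v : Fin n → ℝ) {F : ℝ × (Fin n → ℝ) → ℝ}
    (hF : HasCompactSupport F) : HasCompactSupport (sndDeriv v F) :=
  hF.fderiv_apply (𝕜 := ℝ) (0, v)

/-- Outside a box of controlled size, independent of small perturbations of the shift, the
terms of the lattice sum vanish. -/
theorem exists_support_box {n : ℕ} {F : ℝ × (Fin n → ℝ) → ℝ} (hF : HasCompactSupport F) :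
    ∃ A : ℝ, 0 ≤ A ∧ ∀ T : ℝ, 1 ≤ T → ∀ y : Fin n → ℝ, ∃ B : Finset (Fin n → ℤ),
      (B.card : ℝ) ≤ A * T ^ n ∧ ∀ ρ : ℝ, ∀ y' : Fin n → ℝ, ‖y' - y‖ ≤ 1 → ∀ m, m ∉ B →
        F (ρ, T⁻¹ • ((fun i => (m i : ℝ)) + y')) = 0 := by
  obtain ⟨R, hR⟩ := hF.isCompact.isBounded.exists_norm_le
  refine ⟨(2 * (|R| + 1) + 1) ^ n, by positivity, fun T hT y => ?_⟩
  have hT0 : 0 < T := by linarith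
  obtain ⟨B, hB, hm⟩ := exists_lattice_box y (A := |R| * T + 1) (by positivity)
  refine ⟨B, hB.trans ?_, fun ρ y' hy m hmB => ?_⟩
  · rw [← mul_pow]
    gcongr
    nlinarith [abs_nonneg R]
  · by_contra hne
    refine hmB (hm m ?_)
    have h1 := hR _ (subset_tsupport F hne)
    have h2 := (norm_snd_le _).trans h1
    simp only [norm_smul, norm_inv, Real.norm_eq_abs, abs_of_pos hT0] at h2
    rw [inv_mul_le_iff₀ hT0] at h2
    calc ‖(fun i => (m i : ℝ)) + y‖ = ‖((fun i => (m i : ℝ)) + y') - (y' - y)‖ := by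
          congr 1; abel
      _ ≤ ‖(fun i => (m i : ℝ)) + y'‖ + ‖y' - y‖ := norm_sub_le _ _
      _ ≤ T * R + 1 := add_le_add h2 hy
      _ ≤ |R| * T + 1 := by nlinarith [le_abs_self R]

/-- The factor `T⁻¹` from the chain rule is the source of all the decay. -/
theorem hasDerivAt_latticeSum {n : ℕ} {F : ℝ × (Fin n → ℝ) → ℝ} (hF : ContDiff ℝ ∞ F)
    (hc : HasCompactSupport F) {T : ℝ} (hT : 1 ≤ T) (ρ : ℝ) (y v : Fin n → ℝ) (s : ℝ) :
    HasDerivAt (fun s : ℝ => latticeSum F T ρ (y + s • v))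
      (T⁻¹ * latticeSum (sndDeriv v F) T ρ (y + s • v)) s := by
  obtain ⟨A, -, hA⟩ := exists_support_box hc
  obtain ⟨A', -, hA'⟩ := exists_support_box (hasCompactSupport_sndDeriv v hc)
  obtain ⟨B, -, hB⟩ := hA T hT (y + s • v)
  obtain ⟨B', -, hB'⟩ := hA' T hT (y + s • v)
  classical
  -- One finite box serves all shifts within distance one, so near `s` the series is a fixed finite
  -- sum and can be differentiated termwise.
  have hsum : ∀ᶠ u in 𝓝 s, latticeSum F T ρ (y + u • v)
      = ∑ m ∈ B ∪ B', F (ρ, T⁻¹ • ((fun i => (m i : ℝ)) + (y + u • v))) := by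
    have h0 : Tendsto (fun u : ℝ => ‖(y + u • v) - (y + s • v)‖) (𝓝 s) (𝓝 0) := by
      have : Continuous fun u : ℝ => ‖(y + u • v) - (y + s • v)‖ := by fun_prop
      simpa using this.tendsto s
    filter_upwards [h0.eventually (ge_mem_nhds one_pos)] with u hu
    exact tsum_eq_sum fun m hm => hB ρ _ hu m (fun h => hm (Finset.mem_union_left _ h))
  have hd : latticeSum (sndDeriv v F) T ρ (y + s • v)
      = ∑ m ∈ B ∪ B', sndDeriv v F (ρ, T⁻¹ • ((fun i => (m i : ℝ)) + (y + s • v))) :=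
    tsum_eq_sum fun m hm => hB' ρ _ (by simp) m (fun h => hm (Finset.mem_union_right _ h))
  rw [hd, Finset.mul_sum]
  refine HasDerivAt.congr_of_eventuallyEq ?_ hsum
  refine HasDerivAt.fun_sum fun m _ => ?_
  have hl : HasDerivAt (fun u : ℝ => ((ρ, T⁻¹ • ((fun i => (m i : ℝ)) + (y + u • v))) :
      ℝ × (Fin n → ℝ))) (T⁻¹ • (0, v)) s := by
    rw [Prod.smul_mk, smul_zero]
    refine (hasDerivAt_const s ρ).prodMk ?_
    have h1 : HasDerivAt (fun u : ℝ => u • v) v s := by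
      simpa using (hasDerivAt_id s).smul_const v
    exact ((h1.const_add y).const_add _).const_smul T⁻¹
  have hf := (hF.differentiable (by simp) (ρ, T⁻¹ • ((fun i => (m i : ℝ)) + (y + s • v)))).hasFDerivAt
  have := hf.comp_hasDerivAt s hl
  rw [map_smul, smul_eq_mul] at this
  exact this

theorem abs_latticeSum_le {n : ℕ} {F : ℝ × (Fin n → ℝ) → ℝ} (hF : Continuous F)
    (hc : HasCompactSupport F) :
    ∃ C : ℝ, ∀ T : ℝ, 1 ≤ T → ∀ ρ : ℝ, ∀ y, |latticeSum F T ρ y| ≤ C * T ^ n := by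
  obtain ⟨A, hA0, hA⟩ := exists_support_box hc
  obtain ⟨D, hD⟩ := hF.bounded_above_of_compact_support hc
  have hD0 : 0 ≤ D := (norm_nonneg _).trans (hD 0)
  refine ⟨A * D, fun T hT ρ y => ?_⟩
  obtain ⟨B, hBc, hB⟩ := hA T hT y
  rw [latticeSum, tsum_eq_sum (s := B) fun m hm => hB ρ y (by simp) m hm]
  calc _ ≤ ∑ m ∈ B, |F (ρ, T⁻¹ • ((fun i => (m i : ℝ)) + y))| := Finset.abs_sum_le_sum_abs _ _
    _ ≤ ∑ _m ∈ B, D := Finset.sum_le_sum fun m _ => hD _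
    _ = B.card * D := by simp
    _ ≤ A * T ^ n * D := by gcongr
    _ = _ := by ring

theorem latticeSum_add_single {n : ℕ} (F : ℝ × (Fin n → ℝ) → ℝ) (T ρ : ℝ) (y : Fin n → ℝ)
    (j : Fin n) : latticeSum F T ρ (y + Pi.single j 1) = latticeSum F T ρ y := by
  unfold latticeSum
  rw [← (Equiv.addRight (Pi.single j (1 : ℤ))).tsum_eq
    (fun m : Fin n → ℤ => F (ρ, T⁻¹ • ((fun i => (m i : ℝ)) + y)))]
  refine tsum_congr fun m => ?_
  congr 3
  ext i
  by_cases h : i = j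
  · subst h; simp; ring
  · simp [h]

/-- Lattice sums of coordinate derivatives decay faster than any power of the scale. -/
theorem abs_latticeSum_sndDeriv_le {n : ℕ} (j : Fin n) (K : ℕ) :
    ∀ {F : ℝ × (Fin n → ℝ) → ℝ}, ContDiff ℝ ∞ F → HasCompactSupport F →
    ∃ C : ℝ, ∀ T : ℝ, 1 ≤ T → ∀ ρ : ℝ, ∀ y,
      |latticeSum (sndDeriv (Pi.single j 1) F) T ρ y| ≤ C * T ^ n / T ^ K := by
  induction K with
  | zero =>
    intro F hF hc
    simpa using abs_latticeSum_le (contDiff_sndDeriv (Pi.single j 1) hF).continuous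
      (hasCompactSupport_sndDeriv _ hc)
  | succ K ih =>
    intro F hF hc
    set e : Fin n → ℝ := Pi.single j 1
    have hF' := contDiff_sndDeriv e hF
    have hc' := hasCompactSupport_sndDeriv e hc
    obtain ⟨C, hC⟩ := ih hF' hc'
    refine ⟨C, fun T hT ρ y => ?_⟩
    have hT0 : 0 < T := by linarith
    -- Rolle on one period: the sum takes equal values at `s = 0` and `s = 1`.
    obtain ⟨s, hs, hs0⟩ : ∃ s ∈ Set.Ioo (0 : ℝ) 1,
        T⁻¹ * latticeSum (sndDeriv e F) T ρ (y + s • e) = 0 := by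
      refine exists_hasDerivAt_eq_zero (f := fun s => latticeSum F T ρ (y + s • e)) one_pos
        (fun s _ => (hasDerivAt_latticeSum hF hc hT ρ y e s).continuousAt.continuousWithinAt) ?_
        fun s _ => hasDerivAt_latticeSum hF hc hT ρ y e s
      simp only [zero_smul, add_zero, one_smul]
      exact (latticeSum_add_single F T ρ y j).symm
    have hs1 : latticeSum (sndDeriv e F) T ρ (y + s • e) = 0 := by
      simpa [hT0.ne'] using hs0
    have hC0 : 0 ≤ C * T ^ n / T ^ K := (abs_nonneg _).trans (hC T hT ρ y)
    -- Mean value theorem from the zero `s` back to `0`: the induction hypothesis bounds the second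
    -- derivative, and `T⁻¹` supplies the extra power.
    have hb := (convex_univ (𝕜 := ℝ) (E := ℝ)).norm_image_sub_le_of_norm_hasDerivWithin_le
      (f := fun s => latticeSum (sndDeriv e F) T ρ (y + s • e))
      (C := T⁻¹ * (C * T ^ n / T ^ K)) (x := s) (y := 0)
      (fun u _ => (hasDerivAt_latticeSum hF' hc' hT ρ y e u).hasDerivWithinAt)
      (fun u _ => by
        rw [Real.norm_eq_abs, abs_mul, abs_of_pos (inv_pos.2 hT0)]
        exact mul_le_mul_of_nonneg_left (hC T hT ρ _) (inv_pos.2 hT0).le)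
      (Set.mem_univ _) (Set.mem_univ _)
    simp only [hs1, zero_smul, add_zero, sub_zero, zero_sub, norm_neg, Real.norm_eq_abs,
      abs_of_pos hs.1] at hb
    calc _ ≤ _ := hb
      _ ≤ T⁻¹ * (C * T ^ n / T ^ K) * 1 := by
          gcongr
          exact hs.2.le
      _ = _ := by rw [pow_succ]; field_simp

theorem latticeSum_sndDeriv_eq_sum {n : ℕ} {F : ℝ × (Fin n → ℝ) → ℝ}
    (hc : HasCompactSupport F) {T : ℝ} (hT : 1 ≤ T) (ρ : ℝ) (y v : Fin n → ℝ) :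
    latticeSum (sndDeriv v F) T ρ y
      = ∑ j, v j * latticeSum (sndDeriv (Pi.single j 1) F) T ρ y := by
  have h1 : ∀ z, sndDeriv v F z = ∑ j, v j * sndDeriv (Pi.single j 1) F z := by
    intro z
    have : ((0, v) : ℝ × (Fin n → ℝ)) = ∑ j, v j • ((0, Pi.single j 1) : ℝ × (Fin n → ℝ)) := by
      ext i
      · simp [Prod.fst_sum]
      · simp [Prod.snd_sum, Finset.sum_apply, Pi.single_apply]
    simp only [sndDeriv]
    rw [this, map_sum]
    exact Finset.sum_congr rfl fun j _ => by rw [map_smul, smul_eq_mul]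
  unfold latticeSum
  simp_rw [h1]
  rw [Summable.tsum_finsetSum]
  · simp_rw [tsum_mul_left]
  · intro j _
    obtain ⟨A, -, hA⟩ := exists_support_box (hasCompactSupport_sndDeriv (Pi.single j 1) hc)
    obtain ⟨B, -, hB⟩ := hA T hT y
    exact (summable_of_ne_finset_zero (s := B) fun m hm => hB ρ y (by simp) m hm).mul_left _

/-- The lattice sum depends on the shift only up to `O(T^{-∞})`. -/
theorem abs_latticeSum_sub_le {n : ℕ} {F : ℝ × (Fin n → ℝ) → ℝ} (hF : ContDiff ℝ ∞ F)
    (hc : HasCompactSupport F) (K : ℕ) :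
    ∃ C : ℝ, ∀ T : ℝ, 1 ≤ T → ∀ ρ : ℝ, ∀ y v : Fin n → ℝ, ‖v‖ ≤ 1 →
      |latticeSum F T ρ (y + v) - latticeSum F T ρ y| ≤ C * T ^ n / T ^ K := by
  choose C hC using fun j => abs_latticeSum_sndDeriv_le j K hF hc
  refine ⟨∑ j, C j, fun T hT ρ y v hv => ?_⟩
  have hT0 : 0 < T := by linarith
  have hd : ∀ u : ℝ, |T⁻¹ * latticeSum (sndDeriv v F) T ρ (y + u • v)|
      ≤ (∑ j, C j) * T ^ n / T ^ K := by
    intro u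
    rw [abs_mul, abs_of_pos (inv_pos.2 hT0), latticeSum_sndDeriv_eq_sum hc hT]
    calc _ ≤ 1 * |∑ j, v j * latticeSum (sndDeriv (Pi.single j 1) F) T ρ (y + u • v)| := by
          gcongr
          exact inv_le_one_of_one_le₀ hT
      _ ≤ ∑ j, |v j * latticeSum (sndDeriv (Pi.single j 1) F) T ρ (y + u • v)| := by
          rw [one_mul]; exact Finset.abs_sum_le_sum_abs _ _
      _ ≤ ∑ j, C j * T ^ n / T ^ K := by
          refine Finset.sum_le_sum fun j _ => ?_
          rw [abs_mul]
          calc _ ≤ 1 * |latticeSum (sndDeriv (Pi.single j 1) F) T ρ (y + u • v)| := by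
                gcongr
                exact (norm_le_pi_norm v j).trans hv
            _ ≤ _ := by rw [one_mul]; exact hC j T hT ρ _
      _ = _ := by rw [Finset.sum_mul, Finset.sum_div]
  have hb := (convex_univ (𝕜 := ℝ) (E := ℝ)).norm_image_sub_le_of_norm_hasDerivWithin_le
      (f := fun s => latticeSum F T ρ (y + s • v)) (x := 0) (y := 1)
      (fun u _ => (hasDerivAt_latticeSum hF hc hT ρ y v u).hasDerivWithinAt)
      (fun u _ => hd u) (Set.mem_univ _) (Set.mem_univ _)
  simpa using hb

/-! ### Averaging over a unit cube of shifts -/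

/-- The half-open unit cube with corner the lattice point `m`. -/
def latticeCube {n : ℕ} (m : Fin n → ℤ) : Set (Fin n → ℝ) := {x | ∀ i, ⌊x i⌋ = m i}

theorem latticeCube_eq_pi {n : ℕ} (m : Fin n → ℤ) :
    latticeCube m = Set.univ.pi fun i => Set.Ico (m i : ℝ) (m i + 1) := by
  ext x
  simp [latticeCube, Int.floor_eq_iff]

theorem measurableSet_latticeCube {n : ℕ} (m : Fin n → ℤ) : MeasurableSet (latticeCube m) := by
  rw [latticeCube_eq_pi]
  exact MeasurableSet.univ_pi fun _ => measurableSet_Ico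

theorem volume_latticeCube {n : ℕ} (m : Fin n → ℤ) : volume (latticeCube m) = 1 := by
  rw [latticeCube_eq_pi, volume_pi_pi]
  simp

theorem norm_le_one_of_mem_latticeCube_zero {n : ℕ} {x : Fin n → ℝ}
    (hx : x ∈ latticeCube (0 : Fin n → ℤ)) : ‖x‖ ≤ 1 := by
  rw [latticeCube_eq_pi] at hx
  refine (pi_norm_le_iff_of_nonneg zero_le_one).2 fun i => ?_
  have := hx i trivial
  simp only [Pi.zero_apply, Int.cast_zero, zero_add, Set.mem_Ico] at this
  rw [Real.norm_eq_abs, abs_le]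
  constructor <;> linarith

theorem hasSum_setIntegral_latticeCube {n : ℕ} {f : (Fin n → ℝ) → ℝ} (hf : Integrable f) :
    HasSum (fun m : Fin n → ℤ => ∫ x in latticeCube (0 : Fin n → ℤ), f ((fun i => (m i : ℝ)) + x))
      (∫ x, f x) := by
  have hU : (⋃ m : Fin n → ℤ, latticeCube m) = Set.univ :=
    Set.eq_univ_of_forall fun x => Set.mem_iUnion.2 ⟨fun i => ⌊x i⌋, fun _ => rfl⟩
  have h := hasSum_integral_iUnion (μ := volume) (f := f) (s := fun m : Fin n → ℤ => latticeCube m)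
    measurableSet_latticeCube (fun m m' hmm => Set.disjoint_left.2 fun x hx hx' =>
      hmm (funext fun i => (hx i).symm.trans (hx' i))) hf.integrableOn
  rw [hU, setIntegral_univ] at h
  refine Eq.subst (motive := fun u => HasSum u _) (funext fun m => ?_) h
  symm
  rw [← integral_indicator (measurableSet_latticeCube 0),
    ← integral_indicator (measurableSet_latticeCube m),
    ← integral_add_left_eq_self ((latticeCube m).indicator f) (fun i => (m i : ℝ))]
  congr 1
  ext x
  have hx : (fun i => (m i : ℝ)) + x ∈ latticeCube m ↔ x ∈ latticeCube (0 : Fin n → ℤ) := by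
    simp [latticeCube]
  by_cases h0 : x ∈ latticeCube (0 : Fin n → ℤ)
  · rw [Set.indicator_of_mem h0, Set.indicator_of_mem (hx.2 h0)]
  · rw [Set.indicator_of_notMem h0, Set.indicator_of_notMem fun h => h0 (hx.1 h)]

/-- The mean of the lattice sum over the shifts in a unit cube. -/
theorem setIntegral_latticeSum {n : ℕ} {F : ℝ × (Fin n → ℝ) → ℝ} (hF : Continuous F)
    (hc : HasCompactSupport F) {T : ℝ} (hT : 1 ≤ T) (ρ : ℝ) (y : Fin n → ℝ) :
    IntegrableOn (fun v => latticeSum F T ρ (y + v)) (latticeCube 0) ∧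
    ∫ v in latticeCube (0 : Fin n → ℤ), latticeSum F T ρ (y + v) = ∫ x, F (ρ, T⁻¹ • x) := by
  have hT0 : 0 < T := by linarith
  obtain ⟨A, -, hA⟩ := exists_support_box hc
  obtain ⟨B, -, hB⟩ := hA T hT y
  have hcont : ∀ w : Fin n → ℝ, Continuous fun x => F (ρ, T⁻¹ • (w + x)) := fun w => by fun_prop
  have hint : ∀ w : Fin n → ℝ, Integrable fun x => F (ρ, T⁻¹ • (w + x)) := by
    intro w
    refine (hcont w).integrable_of_hasCompactSupport ?_
    obtain ⟨R, hR⟩ := hc.isCompact.isBounded.exists_norm_le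
    refine HasCompactSupport.intro (isCompact_closedBall (-w) (T * R)) fun x hx => ?_
    by_contra hne
    refine hx ?_
    have h2 := (norm_snd_le _).trans (hR _ (subset_tsupport F hne))
    simp only [norm_smul, norm_inv, Real.norm_eq_abs, abs_of_pos hT0] at h2
    rw [inv_mul_le_iff₀ hT0] at h2
    rwa [mem_closedBall_iff_norm, sub_neg_eq_add, add_comm]
  have heq : Set.EqOn (fun v => latticeSum F T ρ (y + v))
      (fun v => ∑ m ∈ B, F (ρ, T⁻¹ • ((fun i => (m i : ℝ)) + (y + v)))) (latticeCube 0) :=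
    fun v hv => tsum_eq_sum fun m hm =>
      hB ρ _ (by simpa using norm_le_one_of_mem_latticeCube_zero hv) m hm
  have hint' : ∀ m ∈ B, IntegrableOn (fun v => F (ρ, T⁻¹ • ((fun i => (m i : ℝ)) + (y + v))))
      (latticeCube 0) := fun m _ => by
    simpa only [add_assoc] using (hint ((fun i => (m i : ℝ)) + y)).integrableOn
  refine ⟨(integrableOn_congr_fun heq (measurableSet_latticeCube 0)).2 (integrable_finsetSum B hint'), ?_⟩
  rw [setIntegral_congr_fun (measurableSet_latticeCube 0) heq, integral_finsetSum B hint']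
  have hs := hasSum_setIntegral_latticeCube (hint y)
  rw [integral_add_left_eq_self (fun x => F (ρ, T⁻¹ • x)) y] at hs
  rw [← hs.tsum_eq, tsum_eq_sum (s := B)]
  · exact Finset.sum_congr rfl fun m _ => by simp only [add_left_comm y]
  · intro m hm
    refine setIntegral_eq_zero_of_forall_eq_zero fun v hv => ?_
    rw [add_left_comm]
    exact hB ρ _ (by simpa using norm_le_one_of_mem_latticeCube_zero hv) m hm

/-- A smooth lattice sum is given by the integral up to `O(T^{-∞})`. -/
theorem abs_latticeSum_sub_integral_le {n : ℕ} {F : ℝ × (Fin n → ℝ) → ℝ} (hF : ContDiff ℝ ∞ F)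
    (hc : HasCompactSupport F) (K : ℕ) :
    ∃ C : ℝ, ∀ T : ℝ, 1 ≤ T → ∀ ρ : ℝ, ∀ y : Fin n → ℝ,
      |latticeSum F T ρ y - ∫ x, F (ρ, T⁻¹ • x)| ≤ C * T ^ n / T ^ K := by
  obtain ⟨C, hC⟩ := abs_latticeSum_sub_le hF hc K
  refine ⟨C, fun T hT ρ y => ?_⟩
  obtain ⟨hi, he⟩ := setIntegral_latticeSum hF.continuous hc hT ρ y
  have hv : volume.real (latticeCube (0 : Fin n → ℤ)) = 1 := by
    simp [Measure.real, volume_latticeCube]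
  have hlt : volume (latticeCube (0 : Fin n → ℤ)) < ⊤ := by simp [volume_latticeCube]
  have h1 : ∫ v in latticeCube (0 : Fin n → ℤ),
      (latticeSum F T ρ (y + v) - latticeSum F T ρ y) =
      (∫ x, F (ρ, T⁻¹ • x)) - latticeSum F T ρ y := by
    rw [integral_sub hi (integrableOn_const hlt.ne), he, setIntegral_const, hv, one_smul]
  rw [abs_sub_comm, ← h1, ← Real.norm_eq_abs]
  refine (norm_setIntegral_le_of_norm_le_const hlt fun v hv => ?_).trans_eq (by rw [hv, mul_one])
  exact hC T hT ρ y v (norm_le_one_of_mem_latticeCube_zero hv)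

/-! ### The norm of the quadratic form -/

theorem quadForm_smul {n : ℕ} (M : Matrix (Fin n) (Fin n) ℤ) (c : ℝ) (x : Fin n → ℝ) :
    quadForm M (c • x) = c ^ 2 * quadForm M x := by
  simp only [quadForm, Matrix.mulVec_smul, smul_dotProduct, dotProduct_smul, smul_eq_mul]
  ring

theorem contDiff_quadForm {n : ℕ} (M : Matrix (Fin n) (Fin n) ℤ) : ContDiff ℝ ∞ (quadForm M) := by
  unfold quadForm Matrix.mulVec dotProduct
  fun_prop

theorem quadForm_pos {n : ℕ} {M : Matrix (Fin n) (Fin n) ℤ} (hM : IsPosDefInt M)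
    {x : Fin n → ℝ} (hx : x ≠ 0) : 0 < quadForm M x := by
  have := hM.dotProduct_mulVec_pos hx
  rwa [star_trivial, dotProduct_comm] at this

/-- The norm attached to the quadratic form of `M`. -/
noncomputable def quadNorm {n : ℕ} (M : Matrix (Fin n) (Fin n) ℤ) (x : Fin n → ℝ) : ℝ :=
  √(quadForm M x)

theorem quadNorm_smul {n : ℕ} (M : Matrix (Fin n) (Fin n) ℤ) {c : ℝ} (hc : 0 ≤ c)
    (x : Fin n → ℝ) : quadNorm M (c • x) = c * quadNorm M x := by
  rw [quadNorm, quadForm_smul, Real.sqrt_mul (sq_nonneg c), Real.sqrt_sq hc, quadNorm]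

theorem continuous_quadNorm {n : ℕ} (M : Matrix (Fin n) (Fin n) ℤ) : Continuous (quadNorm M) :=
  (contDiff_quadForm M).continuous.sqrt

theorem mem_ellipsoid_iff {n : ℕ} {M : Matrix (Fin n) (Fin n) ℤ} {c x : Fin n → ℝ} {t : ℝ}
    (ht : 0 ≤ t) : x ∈ ellipsoid M c t ↔ quadNorm M (x - c) ≤ t := by
  rw [quadNorm, Real.sqrt_le_iff]
  simp [ellipsoid, ht]

/-- Compactness of the unit sphere gives a positive minimum of `quadNorm`, and homogeneity extends
the bound. The sphere is empty only in dimension zero. -/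
theorem exists_norm_le_mul_quadNorm {n : ℕ} {M : Matrix (Fin n) (Fin n) ℤ} (hM : IsPosDefInt M) :
    ∃ R : ℝ, 0 ≤ R ∧ ∀ x, ‖x‖ ≤ R * quadNorm M x := by
  rcases (Metric.sphere (0 : Fin n → ℝ) 1).eq_empty_or_nonempty with h | h
  · refine ⟨0, le_rfl, fun x => ?_⟩
    by_contra hx
    have hx0 : ‖x‖ ≠ 0 := fun h0 => hx (by simp [h0])
    have : ‖x‖⁻¹ • x ∈ Metric.sphere (0 : Fin n → ℝ) 1 := by
      simp [norm_smul, hx0]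
    simp [h] at this
  · obtain ⟨z, hz, hmin⟩ := (isCompact_sphere (0 : Fin n → ℝ) 1).exists_isMinOn h
      (continuous_quadNorm M).continuousOn
    have hz0 : z ≠ 0 := by
      rintro rfl
      simp at hz
    have hpos : 0 < quadNorm M z := Real.sqrt_pos.2 (quadForm_pos hM hz0)
    refine ⟨(quadNorm M z)⁻¹, by positivity, fun x => ?_⟩
    rcases eq_or_ne x 0 with rfl | hx
    · simp only [norm_zero]
      exact mul_nonneg (by positivity) (Real.sqrt_nonneg _)
    · have hx0 : 0 < ‖x‖ := norm_pos_iff.2 hx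
      have hmem : ‖x‖⁻¹ • x ∈ Metric.sphere (0 : Fin n → ℝ) 1 := by
        simp [norm_smul, hx0.ne']
      have h1 : quadNorm M z ≤ ‖x‖⁻¹ * quadNorm M x := by
        rw [← quadNorm_smul M (by positivity)]
        exact hmin hmem
      rw [le_inv_mul_iff₀ hx0] at h1
      rw [le_inv_mul_iff₀ hpos]
      linarith

open scoped Pointwise in
theorem volume_ellipsoid {n : ℕ} (M : Matrix (Fin n) (Fin n) ℤ) {t : ℝ} (ht : 0 < t) :
    volume.real (ellipsoid M 0 t) = ellipsoidVolume M * t ^ n := by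
  have h : ellipsoid M 0 t = t • ellipsoid M 0 1 := by
    ext x
    rw [Set.mem_smul_set_iff_inv_smul_mem₀ ht.ne', mem_ellipsoid_iff ht.le,
      mem_ellipsoid_iff zero_le_one, sub_zero, sub_zero, quadNorm_smul M (by positivity),
      inv_mul_le_iff₀ ht, mul_one]
  rw [h, Measure.real, Measure.addHaar_smul, ENNReal.toReal_mul, ellipsoidVolume]
  simp [abs_of_pos ht, mul_comm, ht.le]

/-! ### Weighted counts as lattice sums -/

/-- The integral of a weight over `[r, ∞)`. -/
noncomputable def upperIntegral (w : ℝ → ℝ) (r : ℝ) : ℝ := ∫ t in Set.Ici r, w t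

theorem upperIntegral_eq_zero {w : ℝ → ℝ} {b r : ℝ} (hb : ∀ t, b < t → w t = 0) (hr : b < r) :
    upperIntegral w r = 0 :=
  setIntegral_eq_zero_of_forall_eq_zero fun t ht => hb t (hr.trans_le ht)

section Weight

variable {n : ℕ} {M : Matrix (Fin n) (Fin n) ℤ} {w : ℝ → ℝ} {b : ℝ}

/-- Each lattice point is counted exactly for `t` at least its distance to `α`, hence contributes an
upper integral of `w`. Vanishing for `t ≤ 0` matters because `ellipsoid` depends only on `t ^ 2`. -/
theorem integral_latticeCount_mul (hM : IsPosDefInt M) (α : Fin n → ℝ) (hw : Integrable w)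
    (hw0 : ∀ t ≤ 0, w t = 0) (hb : ∀ t, b < t → w t = 0) :
    Integrable (fun t => latticeCount M α t * w t) ∧
    ∫ t, latticeCount M α t * w t
      = ∑' m : Fin n → ℤ, upperIntegral w (quadNorm M ((fun i => (m i : ℝ)) + -α)) := by
  classical
  obtain ⟨R, hR0, hR⟩ := exists_norm_le_mul_quadNorm hM
  obtain ⟨B, -, hB⟩ := exists_lattice_box (-α) (A := R * |b|) (by positivity)
  have hB' : ∀ m : Fin n → ℤ, quadNorm M ((fun i => (m i : ℝ)) + -α) ≤ b → m ∈ B := fun m hm =>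
    hB m ((hR _).trans (mul_le_mul_of_nonneg_left (hm.trans (le_abs_self b)) hR0))
  have heq : (fun t => latticeCount M α t * w t) = fun t => ∑ m ∈ B,
      (Set.Ici (quadNorm M ((fun i => (m i : ℝ)) + -α))).indicator w t := by
    ext t
    by_cases ht : 0 < t ∧ t ≤ b
    · have hset : {m : Fin n → ℤ | (fun i => (m i : ℝ)) ∈ ellipsoid M α t}
          = ↑(B.filter fun m => quadNorm M ((fun i => (m i : ℝ)) + -α) ≤ t) := by
        ext m
        simp only [Set.mem_ofPred_eq, mem_ellipsoid_iff ht.1.le, Finset.coe_filter,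
          sub_eq_add_neg]
        exact ⟨fun h => ⟨hB' m (h.trans ht.2), h⟩, fun h => h.2⟩
      rw [latticeCount, hset, Set.ncard_coe_finset, Finset.card_filter]
      push_cast
      rw [Finset.sum_mul]
      refine Finset.sum_congr rfl fun m _ => ?_
      simp [Set.indicator_apply]
    · have : w t = 0 := by
        by_contra h
        exact ht ⟨not_le.1 fun h' => h (hw0 t h'), not_lt.1 fun h' => h (hb t h')⟩
      simp [this, Set.indicator_apply]
  have hi : ∀ m ∈ B, Integrable
      ((Set.Ici (quadNorm M ((fun i => (m i : ℝ)) + -α))).indicator w) :=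
    fun m _ => hw.indicator measurableSet_Ici
  rw [heq]
  refine ⟨integrable_finsetSum B hi, ?_⟩
  rw [integral_finsetSum B hi, tsum_eq_sum (s := B)]
  · exact Finset.sum_congr rfl fun m _ => integral_indicator measurableSet_Ici
  · intro m hm
    exact upperIntegral_eq_zero hb (not_le.1 fun h => hm (hB' m h))

/-- Fubini on the cone `{(x, t) | quadNorm M x ≤ t}`: its slice at `t > 0` is an ellipsoid, its
slice at `x` a half-line. -/
theorem integral_ellipsoidVolume_mul (hM : IsPosDefInt M) (hw : Integrable w)
    (hw0 : ∀ t ≤ 0, w t = 0) (hb : ∀ t, b < t → w t = 0) :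
    Integrable (fun t => ellipsoidVolume M * t ^ n * w t) ∧
    ∫ t, ellipsoidVolume M * t ^ n * w t = ∫ x, upperIntegral w (quadNorm M x) := by
  obtain ⟨R, hR0, hR⟩ := exists_norm_le_mul_quadNorm hM
  set S : Set ((Fin n → ℝ) × ℝ) := {p | quadNorm M p.1 ≤ p.2}
  have hS : MeasurableSet S :=
    (isClosed_le ((continuous_quadNorm M).comp continuous_fst) continuous_snd).measurableSet
  have hball : Integrable ((Metric.closedBall (0 : Fin n → ℝ) (R * |b|)).indicator
      fun _ => (1 : ℝ)) :=
    (integrable_indicator_iff measurableSet_closedBall).2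
      (integrableOn_const measure_closedBall_lt_top.ne)
  have hint : Integrable (S.indicator fun p => w p.2) (volume.prod volume) := by
    have h := (hball.mul_prod hw).indicator hS
    refine h.congr (Eventually.of_forall ?_)
    rintro ⟨x, t⟩
    by_cases hp : (x, t) ∈ S
    · rw [Set.indicator_of_mem hp, Set.indicator_of_mem hp]
      by_cases ht : b < t
      · simp [hb t ht]
      · have hx : x ∈ Metric.closedBall (0 : Fin n → ℝ) (R * |b|) := by
          rw [mem_closedBall_zero_iff]
          refine (hR x).trans (mul_le_mul_of_nonneg_left ?_ hR0)
          exact (le_trans hp (not_lt.1 ht)).trans (le_abs_self b)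
        simp only [Set.indicator_of_mem hx, one_mul]
    · rw [Set.indicator_of_notMem hp, Set.indicator_of_notMem hp]
  have h1 : ∀ t, ∫ x, S.indicator (fun p => w p.2) (x, t) = ellipsoidVolume M * t ^ n * w t := by
    intro t
    rcases le_or_gt t 0 with ht | ht
    · simp [hw0 t ht, Set.indicator_apply]
    · have : (fun x => S.indicator (fun p => w p.2) (x, t))
          = (ellipsoid M 0 t).indicator fun _ => w t := by
        ext x
        have : (x, t) ∈ S ↔ x ∈ ellipsoid M 0 t := by
          rw [mem_ellipsoid_iff ht.le, sub_zero]
          rfl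
        by_cases hx : x ∈ ellipsoid M 0 t
        · rw [Set.indicator_of_mem hx, Set.indicator_of_mem (this.2 hx)]
        · rw [Set.indicator_of_notMem hx, Set.indicator_of_notMem (mt this.1 hx)]
      have hE : MeasurableSet (ellipsoid M 0 t) := by
        have : ellipsoid M 0 t = {x | quadNorm M x ≤ t} := by
          ext x
          simp [mem_ellipsoid_iff ht.le]
        rw [this]
        exact (isClosed_le (continuous_quadNorm M) continuous_const).measurableSet
      rw [this, integral_indicator hE, setIntegral_const, volume_ellipsoid M ht, smul_eq_mul]
  have h2 : ∀ x, ∫ t, S.indicator (fun p => w p.2) (x, t) = upperIntegral w (quadNorm M x) :=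
    fun x => integral_indicator (s := Set.Ici (quadNorm M x)) measurableSet_Ici
  constructor
  · simpa only [h1] using hint.integral_prod_right
  · simp only [← h1, ← h2]
    exact (integral_integral_swap (f := fun x t => S.indicator (fun p => w p.2) (x, t)) hint).symm

/-- The weighted integral of the discrepancy of the lattice count. -/
theorem integral_discrepancy_mul (hM : IsPosDefInt M) (α : Fin n → ℝ) (hw : Integrable w)
    (hw0 : ∀ t ≤ 0, w t = 0) (hb : ∀ t, b < t → w t = 0) :
    Integrable (fun t => (latticeCount M α t - ellipsoidVolume M * t ^ n) * w t) ∧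
    ∫ t, (latticeCount M α t - ellipsoidVolume M * t ^ n) * w t
      = ∑' m : Fin n → ℤ, upperIntegral w (quadNorm M ((fun i => (m i : ℝ)) + -α))
        - ∫ x, upperIntegral w (quadNorm M x) := by
  obtain ⟨h1, h2⟩ := integral_latticeCount_mul hM α hw hw0 hb
  obtain ⟨h3, h4⟩ := integral_ellipsoidVolume_mul hM hw hw0 hb
  simp only [sub_mul]
  exact ⟨h1.sub h3, by rw [integral_sub h1 h3, h2, h4]⟩

end Weight

/-! ### The smooth kernel and uniformity in the shift -/

theorem upperIntegral_eq_sub {ψ : ℝ → ℝ} (hi : Integrable ψ) (r : ℝ) :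
    upperIntegral ψ r = upperIntegral ψ 0 - ∫ t in (0 : ℝ)..r, ψ t := by
  rw [upperIntegral, upperIntegral, integral_Ici_eq_integral_Ioi, integral_Ici_eq_integral_Ioi,
    ← intervalIntegral.integral_Ioi_sub_Ioi' hi.integrableOn hi.integrableOn]
  ring

theorem contDiff_upperIntegral {ψ : ℝ → ℝ} (hψ : ContDiff ℝ ∞ ψ) (hi : Integrable ψ) :
    ContDiff ℝ ∞ (upperIntegral ψ) := by
  have hd : ∀ r, HasDerivAt (fun r => ∫ t in (0 : ℝ)..r, ψ t) (ψ r) r := fun r =>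
    (hψ.continuous.integral_hasStrictDerivAt 0 r).hasDerivAt
  have h : ContDiff ℝ ∞ fun r => ∫ t in (0 : ℝ)..r, ψ t := by
    refine contDiff_infty_iff_deriv.2 ⟨fun r => (hd r).differentiableAt, ?_⟩
    rwa [show deriv (fun r => ∫ t in (0 : ℝ)..r, ψ t) = ψ from funext fun r => (hd r).deriv]
  rw [funext (upperIntegral_eq_sub hi)]
  exact contDiff_const.sub h

theorem upperIntegral_eq_integral {ψ : ℝ → ℝ} {a r : ℝ} (ha : ∀ t < a, ψ t = 0) (hr : r ≤ a) :
    upperIntegral ψ r = ∫ t, ψ t :=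
  setIntegral_eq_integral_of_forall_compl_eq_zero fun t ht => ha t ((not_le.1 ht).trans_le hr)

theorem upperIntegral_comp_affine {ψ : ℝ → ℝ} {T : ℝ} (hT : 0 < T) (ε r : ℝ) :
    upperIntegral (fun u => ψ ((u - ε) / T)) r = T * upperIntegral ψ ((r - ε) / T) := by
  have h : ∀ u, (Set.Ici r).indicator (fun u => ψ ((u - ε) / T)) u
      = (Set.Ici ((r - ε) / T)).indicator ψ ((u - ε) / T) := by
    intro u
    have : (u - ε) / T ∈ Set.Ici ((r - ε) / T) ↔ u ∈ Set.Ici r := by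
      simp [div_le_div_iff_of_pos_right hT]
    by_cases hu : u ∈ Set.Ici r
    · rw [Set.indicator_of_mem hu, Set.indicator_of_mem (this.2 hu)]
    · rw [Set.indicator_of_notMem hu, Set.indicator_of_notMem (mt this.1 hu)]
  rw [upperIntegral, ← integral_indicator measurableSet_Ici, funext h,
    integral_sub_right_eq_self (fun u => (Set.Ici ((r - ε) / T)).indicator ψ (u / T)) ε,
    Measure.integral_comp_div, integral_indicator measurableSet_Ici, abs_of_pos hT, smul_eq_mul,
    upperIntegral]

/-- A smooth bump function on the line that equals one on `[-1, 1]`. -/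
noncomputable def unitBump : ContDiffBump (0 : ℝ) := ⟨1, 2, one_pos, one_lt_two⟩

/-- The kernel `(ρ, x) ↦ ∫_{t ≥ |x|_M - ρ²} ψ(t) dt`, cut off in `ρ`. -/
noncomputable def radialKernel {n : ℕ} (M : Matrix (Fin n) (Fin n) ℤ) (ψ : ℝ → ℝ)
    (z : ℝ × (Fin n → ℝ)) : ℝ :=
  unitBump z.1 * upperIntegral ψ (quadNorm M z.2 - z.1 ^ 2)

section Kernel

variable {n : ℕ} {M : Matrix (Fin n) (Fin n) ℤ} {ψ : ℝ → ℝ} {a b : ℝ}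

/-- The only danger is `x = 0`, where `quadNorm` is not smooth. There the kernel does not depend on
`x`, since `ψ` vanishes below `a` and the argument stays below `a`. The parameter enters as `ρ ^ 2`
so that this holds for every real `ρ`, of either sign. -/
theorem contDiff_radialKernel (hψ : ContDiff ℝ ∞ ψ) (hi : Integrable ψ) (ha : 0 < a)
    (hψa : ∀ t < a, ψ t = 0) : ContDiff ℝ ∞ (radialKernel M ψ) := by
  have hbump : ContDiff ℝ ∞ fun z : ℝ × (Fin n → ℝ) => unitBump z.1 :=
    unitBump.contDiff.comp contDiff_fst
  refine contDiff_iff_contDiffAt.2 fun z => hbump.contDiffAt.mul ?_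
  by_cases hz : quadNorm M z.2 < a
  · refine (contDiffAt_const (c := ∫ t, ψ t)).congr_of_eventuallyEq ?_
    have hopen : IsOpen {z : ℝ × (Fin n → ℝ) | quadNorm M z.2 < a} :=
      isOpen_lt ((continuous_quadNorm M).comp continuous_snd) continuous_const
    filter_upwards [hopen.mem_nhds hz] with z' hz'
    refine upperIntegral_eq_integral hψa ?_
    have : quadNorm M z'.2 < a := hz'
    nlinarith [sq_nonneg z'.1]
  · have hq : quadForm M z.2 ≠ 0 := by
      intro h
      rw [quadNorm, h, Real.sqrt_zero] at hz
      exact hz ha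
    have hs : ContDiffAt ℝ ∞ (fun z : ℝ × (Fin n → ℝ) => quadNorm M z.2) z :=
      ((contDiff_quadForm M).comp contDiff_snd).contDiffAt.sqrt hq
    exact (contDiff_upperIntegral hψ hi).contDiffAt.comp z
      (hs.sub (contDiff_fst.pow 2).contDiffAt)

theorem hasCompactSupport_radialKernel (hM : IsPosDefInt M) (hψb : ∀ t, b < t → ψ t = 0) :
    HasCompactSupport (radialKernel M ψ) := by
  obtain ⟨R, hR0, hR⟩ := exists_norm_le_mul_quadNorm hM
  -- The bump vanishes for `|ρ| ≥ 2`, so the shift `ρ ^ 2` is at most `4` wherever it matters.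
  refine HasCompactSupport.intro ((isCompact_closedBall (0 : ℝ) 2).prod
    (isCompact_closedBall (0 : Fin n → ℝ) (R * (b + 4)))) ?_
  rintro ⟨ρ, x⟩ h
  by_cases hρ : |ρ| ≤ 2
  · have hx : ¬ ‖x‖ ≤ R * (b + 4) := fun hx => h ⟨by simpa using hρ, by simpa using hx⟩
    have hq : b + 4 < quadNorm M x := by
      by_contra hq
      exact hx ((hR x).trans (mul_le_mul_of_nonneg_left (not_lt.1 hq) hR0))
    have hρ2 : ρ ^ 2 ≤ 4 := by
      have := sq_le_sq' (abs_le.1 hρ).1 (abs_le.1 hρ).2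
      linarith
    rw [radialKernel, upperIntegral_eq_zero hψb (by change b < quadNorm M x - ρ ^ 2; linarith), mul_zero]
  · rw [radialKernel, unitBump.zero_of_le_dist, zero_mul]
    simpa [unitBump] using (not_le.1 hρ).le

theorem radialKernel_sqrt {T ε : ℝ} (hT : 0 < T) (hε : 0 ≤ ε) (hεT : ε ≤ T) (x : Fin n → ℝ) :
    T * radialKernel M ψ (√(ε / T), T⁻¹ • x)
      = upperIntegral (fun u => ψ ((u - ε) / T)) (quadNorm M x) := by
  have h1 : unitBump √(ε / T) = 1 := by
    refine unitBump.one_of_mem_closedBall ?_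
    rw [mem_closedBall_zero_iff, Real.norm_of_nonneg (Real.sqrt_nonneg _)]
    exact Real.sqrt_le_one.2 ((div_le_one hT).2 hεT)
  rw [upperIntegral_comp_affine hT, radialKernel, h1, one_mul,
    Real.sq_sqrt (div_nonneg hε hT.le), quadNorm_smul M (by positivity)]
  congr 2
  ring

/-- Translating `t` by `ε` moves the shift from the discrepancy onto the weight. -/
theorem integrable_discrepancy_mul_comp (hM : IsPosDefInt M) (α : Fin n → ℝ) (hi : Integrable ψ)
    (hψ0 : ∀ t ≤ 0, ψ t = 0) (hψb : ∀ t, b < t → ψ t = 0) {T ε : ℝ} (hT : 0 < T) (hε : 0 ≤ ε) :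
    Integrable (fun t => (latticeCount M α (t + ε) - ellipsoidVolume M * (t + ε) ^ n) * ψ (t / T))
      ∧ ∫ t, (latticeCount M α (t + ε) - ellipsoidVolume M * (t + ε) ^ n) * ψ (t / T)
      = ∑' m : Fin n → ℤ, upperIntegral (fun u => ψ ((u - ε) / T))
          (quadNorm M ((fun i => (m i : ℝ)) + -α))
        - ∫ x, upperIntegral (fun u => ψ ((u - ε) / T)) (quadNorm M x) := by
  have hw : Integrable fun u => ψ ((u - ε) / T) :=
    (hi.comp_div hT.ne').comp_sub_right ε
  obtain ⟨h1, h2⟩ := integral_discrepancy_mul (b := b * T + ε) hM α hw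
    (fun t ht => hψ0 _ (div_nonpos_of_nonpos_of_nonneg (by linarith) hT.le))
    (fun t ht => hψb _ (by rw [lt_div_iff₀ hT]; linarith))
  have h3 := integral_add_right_eq_self (μ := volume) (fun t =>
    (latticeCount M α t - ellipsoidVolume M * t ^ n) * ψ ((t - ε) / T)) ε
  simp only [add_sub_cancel_right] at h3
  rw [h3, h2]
  exact ⟨by simpa only [add_sub_cancel_right] using h1.comp_add_right ε, rfl⟩

/-- Smooth weighted means of the discrepancy are `O(T^{-∞})`, uniformly in shifts by `ε ≤ T`. -/
theorem abs_integral_discrepancy_mul_comp_le (hM : IsPosDefInt M) (α : Fin n → ℝ)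
    (hψ : ContDiff ℝ ∞ ψ) (hi : Integrable ψ) (ha : 0 < a) (hψa : ∀ t < a, ψ t = 0)
    (hψb : ∀ t, b < t → ψ t = 0) (K : ℕ) :
    ∃ C : ℝ, ∀ T ε : ℝ, 1 ≤ T → 0 ≤ ε → ε ≤ T →
      |∫ t, (latticeCount M α (t + ε) - ellipsoidVolume M * (t + ε) ^ n) * ψ (t / T)|
        ≤ C / T ^ K := by
  -- The extra `n + 1` powers absorb the `T ^ n` of the lattice sum bound and the factor `T` from
  -- rescaling the upper integral.
  obtain ⟨C, hC⟩ := abs_latticeSum_sub_integral_le (contDiff_radialKernel (M := M) hψ hi ha hψa)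
    (hasCompactSupport_radialKernel hM hψb) (K + n + 1)
  refine ⟨C, fun T ε hT hε hεT => ?_⟩
  have hT0 : 0 < T := by linarith
  rw [(integrable_discrepancy_mul_comp hM α hi (fun t ht => hψa t (ht.trans_lt ha)) hψb hT0 hε).2]
  simp_rw [← radialKernel_sqrt hT0 hε hεT]
  rw [tsum_mul_left, integral_const_mul, ← mul_sub, abs_mul, abs_of_pos hT0]
  calc _ ≤ T * (C * T ^ n / T ^ (K + n + 1)) :=
        mul_le_mul_of_nonneg_left (hC T hT √(ε / T) (-α)) hT0.le
    _ = _ := by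
        rw [pow_add, pow_add]
        field_simp

end Kernel

/-! ### Absorbing the normalization into the weight, and the theorem -/

/-- The power is singular only at nonpositive `s`, and `μ` vanishes on a neighbourhood of that
range. -/
theorem contDiff_div_rpow {μ : ℝ → ℝ} (hμ : ContDiff ℝ ∞ μ) {a : ℝ} (ha : 0 < a)
    (hμa : ∀ t < a, μ t = 0) (p : ℝ) : ContDiff ℝ ∞ fun s => μ s / s ^ p := by
  refine contDiff_iff_contDiffAt.2 fun s => ?_
  rcases lt_or_ge s a with hs | hs
  · refine (contDiffAt_const (c := (0 : ℝ))).congr_of_eventuallyEq ?_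
    filter_upwards [isOpen_Iio.mem_nhds hs] with u hu
    rw [hμa u hu, zero_div]
  · have hs0 : 0 < s := ha.trans_le hs
    exact hμ.contDiffAt.div (contDiffAt_id.rpow_const_of_ne hs0.ne')
      (Real.rpow_pos_of_pos hs0 p).ne'

theorem div_rpow_mul_rescale {μ : ℝ → ℝ} (hμ0 : ∀ t ≤ 0, μ t = 0) (p x : ℝ) {T : ℝ} (hT : 0 < T)
    (t : ℝ) : x / t ^ p * rescale μ T t = (T * T ^ p)⁻¹ * (x * (μ (t / T) / (t / T) ^ p)) := by
  rcases le_or_gt t 0 with ht | ht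
  · simp [rescale, hμ0 (t / T) (div_nonpos_of_nonpos_of_nonneg ht hT.le)]
  · have h1 := Real.rpow_pos_of_pos hT p
    have h2 := Real.rpow_pos_of_pos ht p
    rw [rescale, Real.div_rpow ht.le hT.le]
    field_simp

end EllipsoidLattice

theorem theorem1p2 (n : ℕ) (hn : 2 ≤ n) (α : Fin n → ℝ)
    (M : Matrix (Fin n) (Fin n) ℤ) (hM : IsPosDefInt M)
    (μ : ℝ → ℝ) (hμ_smooth : ContDiff ℝ ∞ μ) (hμ_compact : HasCompactSupport μ)
    (hμ_nonneg : ∀ t, 0 ≤ μ t) (hμ_supp : tsupport μ ⊆ Set.Ioi 0)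
    (hμ_int : ∫ t : ℝ, μ t = 1) :
    ((∀ T : ℝ, 0 < T → Integrable (fun t : ℝ => deviation M α t * rescale μ T t)) ∧
      Tendsto (fun T : ℝ => smoothAverage μ T (deviation M α)) atTop (𝓝 0)) ∧
    ((∀ T ε : ℝ, 0 < T → 0 < ε →
        Integrable (fun t : ℝ => shellDeviation M α t ε * rescale μ T t)) ∧
      ∀ L C : ℝ, 0 < L → 0 < C → ∀ η : ℝ, 0 < η → ∃ T₀ : ℝ, 0 < T₀ ∧
        ∀ T ε : ℝ, T₀ ≤ T → T ^ (-L) < ε → ε ≤ C →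
          |smoothAverage μ T (fun t => shellDeviation M α t ε)| < η) := by
  -- The closed support misses `0`, hence a whole neighbourhood of it; this gap is what makes the
  -- kernel smooth.
  obtain ⟨a, ha, hμa⟩ : ∃ a : ℝ, 0 < a ∧ ∀ t < a, μ t = 0 := by
    have h0 : (0 : ℝ) ∈ (tsupport μ)ᶜ := fun h => lt_irrefl (0 : ℝ) (hμ_supp h)
    obtain ⟨a, ha, hb⟩ := Metric.isOpen_iff.1 (isClosed_tsupport μ).isOpen_compl 0 h0
    refine ⟨a, ha, fun t ht => image_eq_zero_of_notMem_tsupport fun hmem => ?_⟩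
    have ht0 : 0 < t := hμ_supp hmem
    exact hb (by simpa [abs_of_pos ht0] using ht) hmem
  obtain ⟨b, hμb⟩ : ∃ b : ℝ, ∀ t, b < t → μ t = 0 := by
    obtain ⟨b, hb⟩ := hμ_compact.isCompact.isBounded.exists_norm_le
    exact ⟨b, fun t ht => image_eq_zero_of_notMem_tsupport fun hmem =>
      absurd ((le_abs_self t).trans (hb t hmem)) (not_le.2 ht)⟩
  set p : ℝ := ((n : ℝ) - 1) / 2 with hp
  have hp0 : 0 ≤ p := by
    have : (2 : ℝ) ≤ n := by exact_mod_cast hn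
    rw [hp]
    linarith
  set ψ : ℝ → ℝ := fun s => μ s / s ^ p with hψ_def
  have hψ : ContDiff ℝ ∞ ψ := contDiff_div_rpow hμ_smooth ha hμa p
  have hψa : ∀ t < a, ψ t = 0 := fun t ht => by simp [hψ_def, hμa t ht]
  have hψb : ∀ t, b < t → ψ t = 0 := fun t ht => by simp [hψ_def, hμb t ht]
  have hi : Integrable ψ := hψ.continuous.integrable_of_hasCompactSupport
    (hμ_compact.mono fun t ht h => ht (by simp [hψ_def, h]))
  set D : ℝ → ℝ → ℝ → ℝ := fun T ε t =>
    (latticeCount M α (t + ε) - ellipsoidVolume M * (t + ε) ^ n) * ψ (t / T) with hD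
  have hDi : ∀ T ε : ℝ, 0 < T → 0 ≤ ε → Integrable (D T ε) := fun T ε hT hε =>
    (integrable_discrepancy_mul_comp hM α hi (fun t ht => hψa t (ht.trans_lt ha)) hψb hT hε).1
  have hμ0 : ∀ t ≤ 0, μ t = 0 := fun t ht => hμa t (ht.trans_lt ha)
  have hdev : ∀ T : ℝ, 0 < T → ∀ t,
      deviation M α t * rescale μ T t = (T * T ^ p)⁻¹ * D T 0 t := by
    intro T hT t
    rw [deviation, div_rpow_mul_rescale hμ0 _ _ hT]
    simp only [hD, hψ_def, add_zero, ← hp]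
  have hshell : ∀ T ε : ℝ, 0 < T → ∀ t, shellDeviation M α t ε * rescale μ T t
      = (√ε)⁻¹ * ((T * T ^ p)⁻¹ * (D T ε t - D T 0 t)) := by
    intro T ε hT t
    rw [shellDeviation, ← div_div, div_rpow_mul_rescale hμ0 _ _ hT]
    simp only [hD, hψ_def, add_zero]
    ring
  have hcoef : ∀ T : ℝ, 1 ≤ T → 0 < (T * T ^ p)⁻¹ ∧ (T * T ^ p)⁻¹ ≤ 1 := by
    intro T hT
    have h1 := Real.one_le_rpow hT hp0
    exact ⟨by positivity, inv_le_one_of_one_le₀ (one_le_mul_of_one_le_of_one_le hT h1)⟩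
  refine ⟨⟨fun T hT => ?_, ?_⟩, fun T ε hT hε => ?_, fun L C hL hC η hη => ?_⟩
  · simp_rw [hdev T hT]
    exact (hDi T 0 hT le_rfl).const_mul _
  · obtain ⟨C, hC⟩ := abs_integral_discrepancy_mul_comp_le hM α hψ hi ha hψa hψb 1
    have hlim : Tendsto (fun T : ℝ => C / T ^ 1) atTop (𝓝 0) := by
      simpa using tendsto_const_nhds.div_atTop tendsto_id
    refine squeeze_zero_norm' ?_ hlim
    filter_upwards [eventually_ge_atTop 1] with T hT
    have hT0 : 0 < T := by linarith
    rw [smoothAverage]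
    simp_rw [hdev T hT0]
    rw [integral_const_mul, norm_mul, Real.norm_of_nonneg (hcoef T hT).1.le]
    refine (mul_le_of_le_one_left (norm_nonneg _) (hcoef T hT).2).trans ?_
    exact hC T 0 hT le_rfl hT0.le
  · simp_rw [hshell T ε hT]
    exact (((hDi T ε hT hε.le).sub (hDi T 0 hT le_rfl)).const_mul _).const_mul _
  · obtain ⟨k, hk⟩ := exists_nat_ge L
    -- Of the `k + 1` powers, `k` pay for `(√ε)⁻¹` and the last gives decay.
    obtain ⟨C', hC'⟩ := abs_integral_discrepancy_mul_comp_le hM α hψ hi ha hψa hψb (k + 1)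
    -- `T ≥ C` ensures `ε ≤ T`, as the uniform bound requires; the last term makes `2 * |C'| / T <
    -- η`.
    refine ⟨max (max 1 C) (2 * |C'| / η + 1), by positivity, fun T ε hT hε hεC => ?_⟩
    simp only [max_le_iff] at hT
    obtain ⟨⟨hT1, hTC⟩, hTη⟩ := hT
    have hT0 : 0 < T := by linarith
    have hε0 : 0 < ε := (Real.rpow_pos_of_pos hT0 _).trans hε
    -- The inequality used is `T ^ (-2k) ≤ T ^ (-k) ≤ T ^ (-L) < ε`; `k ≥ L / 2` would suffice.
    have hsqrt : (√ε)⁻¹ ≤ T ^ k := by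
      rw [inv_le_comm₀ (Real.sqrt_pos.2 hε0) (by positivity)]
      refine Real.le_sqrt_of_sq_le ?_
      calc ((T ^ k)⁻¹) ^ 2 ≤ (T ^ k)⁻¹ :=
            pow_le_of_le_one (by positivity) (inv_le_one_of_one_le₀ (one_le_pow₀ hT1)) two_ne_zero
        _ = T ^ (-(k : ℝ)) := by rw [Real.rpow_neg hT0.le, Real.rpow_natCast]
        _ ≤ T ^ (-L) := Real.rpow_le_rpow_of_exponent_le hT1 (neg_le_neg hk)
        _ ≤ ε := hε.le
    rw [smoothAverage]
    simp_rw [hshell T ε hT0]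
    rw [integral_const_mul, integral_const_mul,
      integral_sub (hDi T ε hT0 hε0.le) (hDi T 0 hT0 le_rfl), abs_mul, abs_mul,
      abs_of_pos (hcoef T hT1).1, abs_of_pos (inv_pos.2 (Real.sqrt_pos.2 hε0))]
    have h1 : |(∫ t, D T ε t) - ∫ t, D T 0 t| ≤ 2 * |C'| / T ^ (k + 1) := by
      have e1 := hC' T ε hT1 hε0.le (hεC.trans hTC)
      have e2 := hC' T 0 hT1 le_rfl hT0.le
      have e3 : C' / T ^ (k + 1) ≤ |C'| / T ^ (k + 1) := by
        gcongr
        exact le_abs_self C'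
      calc _ ≤ |∫ t, D T ε t| + |∫ t, D T 0 t| := abs_sub _ _
        _ ≤ |C'| / T ^ (k + 1) + |C'| / T ^ (k + 1) :=
            add_le_add (e1.trans e3) (e2.trans e3)
        _ = _ := by ring
    calc _ ≤ T ^ k * (1 * (2 * |C'| / T ^ (k + 1))) := by
          gcongr
          exact (hcoef T hT1).2
      _ = 2 * |C'| / T := by
          rw [pow_succ]
          field_simp
      _ < η := by
          rw [div_lt_iff₀ hT0]
          have : 2 * |C'| / η < T := by linarith
          rw [div_lt_iff₀ hη] at this
          linarith
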